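/- Work with algebras in the signature $\{\neg,\to\}$ (one unary and one binary operation, nonempty carrier). For $n\ge 1$ let $\mathbf{ŁV}_{n+1}$ be the algebra on $\{0,\tfrac1n,\dots,\tfrac{n-1}n,1\}$ with $\neg x=1-x$ and $x\to y=\min\{1,1-x+y\}$. A quasivariety is a class of algebras axiomatized by quasi-equations $s_1\approx t_1\,\&\cdots\&\,s_m\approx t_m\Rightarrow s\approx t$ ($m\ge 0$), and $\mathcal Q(\mathbf A)$ denotes the quasivariety generated by $\mathbf A$, i.e. the class of all algebras satisfying every quasi-equation valid in $\mathbf A$. Let $\mathbf B$ be the class of all Boolean algebras, regarded as algebras in this signature with $\neg$ the complement and $x\to y=\neg x\vee y$ (the one-element Boolean algebra included). Let $k>1$ be an integer. Then $\mathbf B=\mathcal Q(\mathbf{ŁV}_2)$, and the set of all quasivarieties that are minimal with respect to inclusion among the quasivarieties $K$ with $\mathbf B\subsetneq K\subseteq \mathcal Q(\mathbf{ŁV}_{k+1})$ is $$\{\mathcal Q(\mathbf{ŁV}_{q+1}\times\mathbf{ŁV}_2) : q \text{ prime},\ q\mid k\}.$$ -/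

import Mathlib

universe u v w

namespace Lukasiewicz

open FirstOrder FirstOrder.Language FirstOrder.Language.Structure



/-- The operation symbols of the signature `{¬, →}`, indexed by arity. -/
inductive Op : ℕ → Type
  | neg : Op 1
  | imp : Op 2

/-- The algebraic signature `{¬, →}`. -/
def sig : FirstOrder.Language.{0, 0} := ⟨Op, fun _ => Empty⟩

/-- The operation `¬` of an algebra over `{¬, →}`. -/
def neg {M : Type u} [sig.Structure M] (x : M) : M :=
  funMap (L := sig) (n := 1) Op.neg ![x]

/-- The operation `→` of an algebra over `{¬, →}`. -/
def imp {M : Type u} [sig.Structure M] (x y : M) : M :=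
  funMap (L := sig) (n := 2) Op.imp ![x, y]

/-- Algebras over the signature `{¬, →}`: nonempty sets with two operations, no axioms. -/
abbrev Alg : Type (u + 1) := Theory.ModelType.{0, 0, u} (∅ : sig.Theory)

/-- The direct product of two algebras, with coordinatewise operations. -/
instance instStructureProd (M : Type u) (N : Type v) [sig.Structure M] [sig.Structure N] :
    sig.Structure (M × N) where
  funMap f x := (funMap f fun i => (x i).1, funMap f fun i => (x i).2)
  RelMap r _ := Empty.elim r

/-- For `n ≥ 1`, the set `{0, 1/n, …, (n-1)/n, 1}` (see `mem_chain_iff`), underlying the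
`(n+1)`-valued Łukasiewicz chain. -/
def chain (n : ℕ) : Set ℚ := {x | 0 ≤ x ∧ x ≤ 1 ∧ ∃ z : ℤ, (n : ℚ) * x = z}

theorem mem_chain_iff {n : ℕ} (hn : 1 ≤ n) (x : ℚ) :
    x ∈ chain n ↔ ∃ i : ℕ, i ≤ n ∧ x = (i : ℚ) / n := by
  have hn' : (0 : ℚ) < n := by exact_mod_cast hn
  constructor
  · rintro ⟨h0, h1, z, hz⟩
    have hz0 : (0 : ℤ) ≤ z := by
      have : (0 : ℚ) ≤ z := hz ▸ mul_nonneg hn'.le h0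
      exact_mod_cast this
    obtain ⟨i, rfl⟩ := Int.eq_ofNat_of_zero_le hz0
    refine ⟨i, ?_, ?_⟩
    · have : (n : ℚ) * x ≤ n := by nlinarith
      rw [hz] at this
      exact_mod_cast this
    · rw [eq_div_iff hn'.ne', mul_comm, hz]
      simp
  · rintro ⟨i, hi, rfl⟩
    have hi' : (i : ℚ) ≤ n := by exact_mod_cast hi
    refine ⟨by positivity, (div_le_one hn').2 hi', i, ?_⟩
    rw [mul_div_cancel₀ _ hn'.ne']
    simp

theorem neg_mem_chain {n : ℕ} {x : ℚ} (hx : x ∈ chain n) : 1 - x ∈ chain n := by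
  obtain ⟨h0, h1, z, hz⟩ := hx
  exact ⟨by linarith, by linarith, n - z, by push_cast; linarith⟩

theorem one_mem_chain (n : ℕ) : (1 : ℚ) ∈ chain n :=
  ⟨zero_le_one, le_rfl, n, by simp⟩

theorem imp_mem_chain {n : ℕ} {x y : ℚ} (hx : x ∈ chain n) (hy : y ∈ chain n) :
    min 1 (1 - x + y) ∈ chain n := by
  rcases min_choice 1 (1 - x + y) with h | h
  · rw [h]
    exact one_mem_chain n
  · have h2 : 1 - x + y ≤ 1 := by rw [← h]; exact min_le_left _ _
    rw [h]
    obtain ⟨-, hx1, z, hz⟩ := hx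
    obtain ⟨hy0, -, t, ht⟩ := hy
    exact ⟨by linarith, h2, n - z + t, by push_cast; linarith⟩

/-- The algebra `ŁV_{n+1}` for `n ≥ 1`: the chain `{0, 1/n, …, 1}` with `¬ x = 1 - x` and
`x → y = min {1, 1 - x + y}`. Note that `chain n` has `n + 1` elements. -/
instance instStructureChain (n : ℕ) : sig.Structure (chain n) where
  funMap f := match f with
    | Op.neg => fun x => ⟨1 - (x 0 : ℚ), neg_mem_chain (x 0).2⟩
    | Op.imp => fun x => ⟨min 1 (1 - (x 0 : ℚ) + (x 1 : ℚ)), imp_mem_chain (x 0).2 (x 1).2⟩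
  RelMap r _ := Empty.elim r

/-- A quasi-equation `s₁ ≈ t₁ & … & sₘ ≈ tₘ ⇒ s ≈ t` (`m ≥ 0`) over `{¬, →}`, in the variables
`x₀, x₁, …`. -/
structure QuasiEquation where
  premises : List (sig.Term ℕ × sig.Term ℕ)
  conclusion : sig.Term ℕ × sig.Term ℕ

/-- Validity of a quasi-equation in an algebra. -/
def QuasiEquation.Valid (e : QuasiEquation) (M : Type u) [sig.Structure M] : Prop :=
  ∀ x : ℕ → M, (∀ p ∈ e.premises, p.1.realize x = p.2.realize x) →
    e.conclusion.1.realize x = e.conclusion.2.realize x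

/-- The class of all algebras satisfying a set of quasi-equations. -/
def models (S : Set QuasiEquation) : Set Alg.{u} :=
  {A | ∀ e ∈ S, e.Valid A}

/-- A quasivariety is a class of algebras axiomatized by a set of quasi-equations. -/
def IsQuasivariety (K : Set Alg.{u}) : Prop := ∃ S : Set QuasiEquation, K = models S

/-- `𝒬(M)`, the quasivariety generated by the algebra `M`: all algebras satisfying every
quasi-equation that is valid in `M`. -/
def generated (M : Type w) [sig.Structure M] : Set Alg.{u} :=
  models {e | e.Valid M}

/-- `𝒬(M)` is the smallest quasivariety containing `M`. -/
theorem generated_isLeast (M : Alg.{u}) :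
    IsLeast {K : Set Alg.{u} | IsQuasivariety K ∧ M ∈ K} (generated M) := by
  refine ⟨⟨⟨_, rfl⟩, fun e he => he⟩, ?_⟩
  rintro K ⟨⟨S, rfl⟩, hM⟩ A hA e he
  exact hA e (hM e he)

/-- The class of all Boolean algebras, as algebras over `{¬, →}`: `¬` is the complement and
`x → y` is the Boolean implication. -/
def booleanAlgebras : Set Alg.{u} :=
  {A | ∃ _ : BooleanAlgebra A.Carrier, (∀ x : A, neg x = xᶜ) ∧ ∀ x y : A, imp x y = x ⇨ y}

/-- `K` is a quasivariety contained in `V` and strictly containing `B`. -/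
def IsSubquasivarietyAbove (V B K : Set Alg.{u}) : Prop :=
  IsQuasivariety K ∧ K ⊆ V ∧ B ⊂ K

end Lukasiewicz

namespace Lukasiewicz

open FirstOrder FirstOrder.Language FirstOrder.Language.Structure

/-! ### Terms, homomorphisms and substitution -/

/-! Everything reduces to `exists_generated_subset`: a quasivariety strictly between contains some
`𝒬(ŁV_{q+1} × ŁV_2)` with `q` a prime divisor of `k`. Applied with `k = q` it gives minimality of
that quasivariety, since the only prime dividing `q` is `q`.

To prove it, take a non-Boolean `A` in the class. By `mem_generated_chain_one` it has a
non-idempotent element `a`, and by `exists_specialization` some point `i` of the chain other than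
`0` and `1` satisfies all one-variable equations that `a` satisfies. The unary terms take at `i`
exactly enough values to fill a chain `ŁV_{N+1}` with `1 < N ∣ k` (`exists_subchain`); let `q` be a
prime factor of `N`. Unary terms can moreover be prescribed at `i` and made constantly Boolean
elsewhere (`exists_term_with_values`), so a valuation in `ŁV_{q+1} × ŁV_2` is encoded by unary
terms: first coordinate at `i`, second at all other points. A quasi-equation of `A` can thus be
tested on these terms evaluated at `a` (`exists_prime_valid`). -/

/-- The term `¬ t`. -/
def tneg (t : sig.Term ℕ) : sig.Term ℕ := Functions.apply₁ (L := sig) Op.neg t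

/-- The term `s → t`. -/
def timp (s t : sig.Term ℕ) : sig.Term ℕ := Functions.apply₂ (L := sig) Op.imp s t

@[simp] theorem realize_tneg {M : Type u} [sig.Structure M] (x : ℕ → M) (t : sig.Term ℕ) :
    (tneg t).realize x = neg (t.realize x) :=
  Term.realize_functions_apply₁

@[simp] theorem realize_timp {M : Type u} [sig.Structure M] (x : ℕ → M) (s t : sig.Term ℕ) :
    (timp s t).realize x = imp (s.realize x) (t.realize x) :=
  Term.realize_functions_apply₂

theorem realize_func_neg {M : Type u} [sig.Structure M] (x : ℕ → M) (ts : Fin 1 → sig.Term ℕ) :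
    (Term.func (L := sig) (l := 1) Op.neg ts).realize x = neg ((ts 0).realize x) := by
  refine congrArg (funMap (L := sig) (n := 1) Op.neg) (funext fun j => ?_)
  fin_cases j
  rfl

theorem realize_func_imp {M : Type u} [sig.Structure M] (x : ℕ → M) (ts : Fin 2 → sig.Term ℕ) :
    (Term.func (L := sig) (l := 2) Op.imp ts).realize x =
      imp ((ts 0).realize x) ((ts 1).realize x) := by
  refine congrArg (funMap (L := sig) (n := 2) Op.imp) (funext fun j => ?_)
  fin_cases j <;> rfl

/-- Homomorphisms of algebras over `{¬, →}`. -/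
def IsHom {M : Type u} {N : Type v} [sig.Structure M] [sig.Structure N] (f : M → N) : Prop :=
  (∀ x, f (neg x) = neg (f x)) ∧ ∀ x y, f (imp x y) = imp (f x) (f y)

theorem IsHom.map_realize {M : Type u} {N : Type v} [sig.Structure M] [sig.Structure N]
    {f : M → N} (hf : IsHom f) (x : ℕ → M) (t : sig.Term ℕ) :
    f (t.realize x) = t.realize fun n => f (x n) := by
  induction t with
  | var n => rfl
  | func g ts ih =>
    cases g with
    | neg => rw [realize_func_neg, realize_func_neg, hf.1, ih]
    | imp => rw [realize_func_imp, realize_func_imp, hf.2, ih, ih]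

/-- A quasi-equation is inherited by any algebra whose points are separated by homomorphisms to
algebras in which it is valid. -/
theorem QuasiEquation.Valid.of_separating {e : QuasiEquation} {M : Type u} [sig.Structure M]
    (h : ∀ a b : M, a ≠ b → ∃ (N : Type v) (_ : sig.Structure N) (f : M → N),
      IsHom f ∧ f a ≠ f b ∧ e.Valid N) : e.Valid M := by
  intro x hx
  by_contra hne
  obtain ⟨N, _, f, hf, hfne, hN⟩ := h _ _ hne
  apply hfne
  rw [hf.map_realize, hf.map_realize]
  refine hN _ fun p hp => ?_
  rw [← hf.map_realize, ← hf.map_realize, hx p hp]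

theorem QuasiEquation.Valid.of_injective {e : QuasiEquation} {M : Type u} {N : Type v}
    [sig.Structure M] [sN : sig.Structure N] (he : e.Valid N) {f : M → N} (hf : IsHom f)
    (hi : Function.Injective f) : e.Valid M :=
  .of_separating fun _ _ hab => ⟨N, sN, f, hf, hi.ne hab, he⟩

theorem isHom_fst {M : Type u} {N : Type v} [sig.Structure M] [sig.Structure N] :
    IsHom (Prod.fst : M × N → M) := by
  refine ⟨fun x => congrArg (funMap (L := sig) (n := 1) Op.neg) (funext fun j => ?_),
    fun x y => congrArg (funMap (L := sig) (n := 2) Op.imp) (funext fun j => ?_)⟩ <;>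
  fin_cases j <;> rfl

theorem isHom_snd {M : Type u} {N : Type v} [sig.Structure M] [sig.Structure N] :
    IsHom (Prod.snd : M × N → N) := by
  refine ⟨fun x => congrArg (funMap (L := sig) (n := 1) Op.neg) (funext fun j => ?_),
    fun x y => congrArg (funMap (L := sig) (n := 2) Op.imp) (funext fun j => ?_)⟩ <;>
  fin_cases j <;> rfl

theorem QuasiEquation.Valid.prod {e : QuasiEquation} {M N : Type u} [sM : sig.Structure M]
    [sN : sig.Structure N] (hM : e.Valid M) (hN : e.Valid N) : e.Valid (M × N) := by
  refine .of_separating fun a b hab => ?_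
  by_cases h : a.1 = b.1
  · exact ⟨N, sN, Prod.snd, isHom_snd, fun h' => hab (Prod.ext h h'), hN⟩
  · exact ⟨M, sM, Prod.fst, isHom_fst, h, hM⟩

/-- Substitution of terms for the variables of a quasi-equation. -/
def QuasiEquation.subst (e : QuasiEquation) (F : ℕ → sig.Term ℕ) : QuasiEquation where
  premises := e.premises.map fun p => (p.1.subst F, p.2.subst F)
  conclusion := (e.conclusion.1.subst F, e.conclusion.2.subst F)

theorem QuasiEquation.Valid.subst {e : QuasiEquation} {M : Type u} [sig.Structure M]
    {F : ℕ → sig.Term ℕ}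
    (h : ∀ x : ℕ → M, (∀ p ∈ e.premises, (p.1.realize fun n => (F n).realize x) =
      p.2.realize fun n => (F n).realize x) →
      (e.conclusion.1.realize fun n => (F n).realize x) =
      e.conclusion.2.realize fun n => (F n).realize x) : (e.subst F).Valid M := by
  intro x hx
  simp only [QuasiEquation.subst, Term.realize_subst]
  refine h x fun p hp => ?_
  simpa only [Term.realize_subst] using hx _ (List.mem_map_of_mem hp)

theorem QuasiEquation.Valid.of_subst {e : QuasiEquation} {M : Type u} [sig.Structure M]
    {F : ℕ → sig.Term ℕ} (h : (e.subst F).Valid M) (x : ℕ → M)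
    (hx : ∀ p ∈ e.premises, (p.1.realize fun n => (F n).realize x) =
      p.2.realize fun n => (F n).realize x) :
    (e.conclusion.1.realize fun n => (F n).realize x) =
      e.conclusion.2.realize fun n => (F n).realize x := by
  have := h x ?_
  · simpa only [QuasiEquation.subst, Term.realize_subst] using this
  · intro p hp
    simp only [QuasiEquation.subst, List.mem_map] at hp
    obtain ⟨r, hr, rfl⟩ := hp
    simpa only [Term.realize_subst] using hx r hr

/-! ### The two-element algebra and Boolean algebras -/

/-- A copy of `ŁV_2` in which quasi-equations are checked by cases on truth values. -/
instance instStructureBool : sig.Structure Bool where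
  funMap f := match f with
    | Op.neg => fun x => !(x 0)
    | Op.imp => fun x => !(x 0) || x 1
  RelMap r _ := Empty.elim r

@[simp] theorem neg_bool (x : Bool) : neg x = !x := rfl

@[simp] theorem imp_bool (x y : Bool) : imp x y = (!x || y) := rfl

@[simp] theorem coe_neg {n : ℕ} (x : chain n) : ((neg x : chain n) : ℚ) = 1 - x := rfl

@[simp] theorem coe_imp {n : ℕ} (x y : chain n) :
    ((imp x y : chain n) : ℚ) = min 1 (1 - (x : ℚ) + y) := rfl

theorem zero_mem_chain (n : ℕ) : (0 : ℚ) ∈ chain n := ⟨le_rfl, zero_le_one, 0, by simp⟩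

theorem chain_subset {m n : ℕ} (h : m ∣ n) : chain m ⊆ chain n := by
  rintro x ⟨h0, h1, z, hz⟩
  obtain ⟨c, rfl⟩ := h
  refine ⟨h0, h1, c * z, ?_⟩
  push_cast
  rw [← hz]
  ring

theorem isHom_inclusion {m n : ℕ} (h : m ∣ n) : IsHom (Set.inclusion (chain_subset h)) :=
  ⟨fun _ => rfl, fun _ _ => rfl⟩

/-- Booleans as elements of a Łukasiewicz chain. -/
def ofBool (n : ℕ) (b : Bool) : chain n :=
  cond b ⟨1, one_mem_chain n⟩ ⟨0, zero_mem_chain n⟩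

theorem isHom_ofBool (n : ℕ) : IsHom (ofBool n) := by
  constructor
  · intro x
    cases x <;> apply Subtype.ext <;> simp [ofBool]
  · intro x y
    cases x <;> cases y <;> apply Subtype.ext <;> simp [ofBool]

theorem ofBool_injective (n : ℕ) : Function.Injective (ofBool n) := by
  intro x y h
  have := congrArg Subtype.val h
  cases x <;> cases y <;> simp_all [ofBool]

theorem chain_one_cases (x : chain 1) : (x : ℚ) = 0 ∨ (x : ℚ) = 1 := by
  obtain ⟨i, hi, h⟩ := (mem_chain_iff le_rfl _).1 x.2
  interval_cases i <;> simp [h]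

theorem valid_chain_one_iff {e : QuasiEquation} : e.Valid (chain 1) ↔ e.Valid Bool := by
  refine ⟨fun h => h.of_injective (isHom_ofBool 1) (ofBool_injective 1), fun h => ?_⟩
  have hs : Function.Surjective (ofBool 1) := by
    intro x
    rcases chain_one_cases x with hx | hx
    · exact ⟨false, Subtype.ext hx.symm⟩
    · exact ⟨true, Subtype.ext hx.symm⟩
  have hr := Function.rightInverse_surjInv hs
  refine h.of_injective (f := Function.surjInv hs) ⟨fun x => ?_, fun x y => ?_⟩
    (Function.injective_surjInv hs)
  · apply ofBool_injective 1
    rw [hr, (isHom_ofBool 1).1, hr]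
  · apply ofBool_injective 1
    rw [hr, (isHom_ofBool 1).2, hr, hr]

/-- By the prime ideal theorem, if `a ≰ b` some prime ideal contains `b` but not `a`; membership in
its complement is a homomorphism to `Bool` separating them. -/
theorem QuasiEquation.Valid.of_booleanAlgebra {e : QuasiEquation} (he : e.Valid Bool)
    {A : Type u} [sig.Structure A] [BooleanAlgebra A] (hneg : ∀ x : A, neg x = xᶜ)
    (himp : ∀ x y : A, imp x y = x ⇨ y) : e.Valid A := by
  classical
  have key : ∀ a b : A, ¬ a ≤ b → ∃ f : A → Bool, IsHom f ∧ f a ≠ f b := by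
    intro a b hab
    have hd : Disjoint (Order.PFilter.principal a : Set A) (Order.Ideal.principal b : Set A) := by
      rw [Set.disjoint_left]
      intro x hx hx'
      exact hab (le_trans (Order.PFilter.mem_principal.1 hx) (Order.Ideal.mem_principal.1 hx'))
    obtain ⟨J, hJ, hbJ, hJa⟩ := DistribLattice.prime_ideal_of_disjoint_filter_ideal hd
    have hb : b ∈ J := hbJ (Order.Ideal.mem_principal.2 le_rfl)
    have ha : a ∉ J := Set.disjoint_left.1 hJa (Order.PFilter.mem_principal.2 le_rfl)
    have hc : ∀ x : A, xᶜ ∈ J ↔ x ∉ J := by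
      intro x
      refine ⟨fun h h' => ?_, fun h => hJ.mem_or_compl_mem.resolve_left h⟩
      apply hJ.1.top_notMem
      rw [← sup_compl_eq_top (x := x)]
      exact J.sup_mem h' h
    refine ⟨fun x => decide (x ∉ J), ⟨fun x => ?_, fun x y => ?_⟩, ?_⟩
    · simp [hneg, hc]
    · by_cases h1 : x ∈ J <;> by_cases h2 : y ∈ J <;>
        simp [himp, himp_eq, Order.Ideal.sup_mem_iff, hc, h1, h2]
    · simp [ha, hb]
  refine .of_separating fun a b hab => ?_
  by_cases h : a ≤ b
  · obtain ⟨f, hf, hne⟩ := key b a fun h' => hab (le_antisymm h h')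
    exact ⟨Bool, _, f, hf, hne.symm, he⟩
  · obtain ⟨f, hf, hne⟩ := key a b h
    exact ⟨Bool, _, f, hf, hne, he⟩

/-- Term for the join. -/
def tsup (s t : sig.Term ℕ) : sig.Term ℕ := timp (tneg s) t

/-- Term for the meet. -/
def tinf (s t : sig.Term ℕ) : sig.Term ℕ := tneg (timp s (tneg t))

/-- The equation expressing `s ≤ t`. -/
def tle (s t : sig.Term ℕ) : sig.Term ℕ × sig.Term ℕ := (timp s t, timp s s)

/-- An algebra satisfying the quasi-equations of the two-element algebra is Boolean. -/
@[reducible] noncomputable def booleanAlgebraOfValid (A : Type u) [sig.Structure A] [Nonempty A]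
    (h : ∀ e : QuasiEquation, e.Valid Bool → e.Valid A) : BooleanAlgebra A := by
  have tr : ∀ (P : List (sig.Term ℕ × sig.Term ℕ)) (c : sig.Term ℕ × sig.Term ℕ),
      (QuasiEquation.mk P c).Valid Bool → ∀ x y z : A,
      (∀ p ∈ P, p.1.realize (fun n => if n = 0 then x else if n = 1 then y else z) =
        p.2.realize (fun n => if n = 0 then x else if n = 1 then y else z)) →
      c.1.realize (fun n => if n = 0 then x else if n = 1 then y else z) =
        c.2.realize (fun n => if n = 0 then x else if n = 1 then y else z) :=
    fun P c hPc x y z => h _ hPc _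
  let X : sig.Term ℕ := Term.var 0
  let Y : sig.Term ℕ := Term.var 1
  let Z : sig.Term ℕ := Term.var 2
  -- The signature has no constants, so the top is `o → o` for an arbitrary `o`, and `x ≤ y` is
  -- written `x → y = x → x`.
  let o : A := Classical.arbitrary A
  exact
  { le := fun x y => imp x y = imp x x
    sup := fun x y => imp (neg x) y
    inf := fun x y => neg (imp x (neg y))
    compl := neg
    himp := imp
    top := imp o o
    bot := neg (imp o o)
    le_refl := fun x => rfl
    le_trans := fun x y z h1 h2 => by
      simpa [X, Y, Z, tle, h1, h2] using tr [tle X Y, tle Y Z] (tle X Z) (by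
        intro v; simp [X, Y, Z, tle]
        cases v 0 <;> cases v 1 <;> cases v 2 <;> simp) x y z
    le_antisymm := fun x y h1 h2 => by
      simpa [X, Y, Z, tle, h1, h2] using tr [tle X Y, tle Y X] (X, Y) (by
        intro v; simp [X, Y, tle]; cases v 0 <;> cases v 1 <;> simp) x y y
    le_sup_left := fun x y => by
      simpa [X, Y, Z, tle, tsup] using tr [] (tle X (tsup X Y)) (by
        intro v; simp [X, Y, tle, tsup]; cases v 0 <;> cases v 1 <;> simp) x y y
    le_sup_right := fun x y => by
      simpa [X, Y, Z, tle, tsup] using tr [] (tle Y (tsup X Y)) (by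
        intro v; simp [X, Y, tle, tsup]; cases v 0 <;> cases v 1 <;> simp) x y y
    sup_le := fun x y z h1 h2 => by
      simpa [X, Y, Z, tle, tsup, h1, h2] using tr [tle X Z, tle Y Z] (tle (tsup X Y) Z) (by
        intro v; simp [X, Y, Z, tle, tsup]
        cases v 0 <;> cases v 1 <;> cases v 2 <;> simp) x y z
    inf_le_left := fun x y => by
      simpa [X, Y, Z, tle, tinf] using tr [] (tle (tinf X Y) X) (by
        intro v; simp [X, Y, tle, tinf]; cases v 0 <;> cases v 1 <;> simp) x y y
    inf_le_right := fun x y => by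
      simpa [X, Y, Z, tle, tinf] using tr [] (tle (tinf X Y) Y) (by
        intro v; simp [X, Y, tle, tinf]; cases v 0 <;> cases v 1 <;> simp) x y y
    le_inf := fun x y z h1 h2 => by
      simpa [X, Y, Z, tle, tinf, h1, h2] using tr [tle X Y, tle X Z] (tle X (tinf Y Z)) (by
        intro v; simp [X, Y, Z, tle, tinf]
        cases v 0 <;> cases v 1 <;> cases v 2 <;> simp) x y z
    le_sup_inf := fun x y z => by
      have h := tr [] (tle (tinf (tsup X Y) (tsup X Z)) (tsup X (tinf Y Z))) (by
        intro v; simp [X, Y, Z, tle, tinf, tsup]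
        cases v 0 <;> cases v 1 <;> cases v 2 <;> simp) x y z
      simp only [X, Y, Z, tle, tinf, tsup, realize_timp, realize_tneg, Term.realize_var] at h
      exact h (by simp)
    inf_compl_le_bot := fun x => by
      have h := tr [] (tle (tinf X (tneg X)) (tneg (timp Y Y))) (by
        intro v; simp [X, Y, tle, tinf]) x o o
      simp only [X, Y, tle, tinf, realize_timp, realize_tneg, Term.realize_var] at h
      exact h (by simp)
    top_le_sup_compl := fun x => by
      have h := tr [] (tle (timp Y Y) (tsup X (tneg X))) (by
        intro v; simp [X, Y, tle, tsup]) x o o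
      simp only [X, Y, tle, tsup, realize_timp, realize_tneg, Term.realize_var] at h
      exact h (by simp)
    le_top := fun x => by
      simpa [X, Y, tle] using tr [] (tle X (timp Y Y)) (by
        intro v; simp [X, Y, tle]) x o o
    bot_le := fun x => by
      simpa [X, Y, tle] using tr [] (tle (tneg (timp Y Y)) X) (by
        intro v; simp [X, Y, tle]) x o o
    himp_eq := fun x y => by
      have h := tr [] (timp X Y, tsup Y (tneg X)) (by
        intro v; simp [X, Y, tsup]; cases v 0 <;> cases v 1 <;> simp) x y y
      simp only [X, Y, tsup, realize_timp, realize_tneg, Term.realize_var] at h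
      exact h (by simp) }

theorem booleanAlgebras_eq_generated :
    booleanAlgebras.{u} = generated (chain 1) := by
  ext A
  constructor
  · rintro ⟨_, hneg, himp⟩ e he
    exact (valid_chain_one_iff.1 he).of_booleanAlgebra hneg himp
  · intro hA
    exact ⟨booleanAlgebraOfValid A fun e he => hA e (valid_chain_one_iff.2 he),
      fun _ => rfl, fun _ _ => rfl⟩

/-! ### Unary term functions on a finite chain -/

/-- The value of a term when all variables take the same value. -/
def val {n : ℕ} (t : sig.Term ℕ) (c : chain n) : ℚ := (t.realize fun _ => c : chain n)

section

variable {n : ℕ} (s t : sig.Term ℕ) (c : chain n)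

theorem val_nonneg : 0 ≤ val t c := (t.realize fun _ => c : chain n).2.1

theorem val_le_one : val t c ≤ 1 := (t.realize fun _ => c : chain n).2.2.1

theorem val_var (m : ℕ) : val (Term.var m) c = c := rfl

theorem val_tneg : val (tneg t) c = 1 - val t c := by
  simp [val]

theorem val_timp : val (timp s t) c = min 1 (1 - val s c + val t c) := by
  simp [val]

theorem val_tsup : val (tsup s t) c = min 1 (val s c + val t c) := by
  simp [tsup, val_timp, val_tneg]

theorem val_tinf : val (tinf s t) c = max 0 (val s c + val t c - 1) := by
  rw [tinf, val_tneg, val_timp, val_tneg]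
  rcases le_total 1 (1 - val s c + (1 - val t c)) with h | h
  · rw [min_eq_left h, max_eq_left (by linarith)]; ring
  · rw [min_eq_right h, max_eq_right (by linarith)]; ring

end

/-- The `m`-fold strong conjunction of `t`. -/
def tpow (t : sig.Term ℕ) : ℕ → sig.Term ℕ
  | 0 => timp t t
  | m + 1 => tinf (tpow t m) t

/-- Strong conjunction adds the distances to `1`, truncating the sum at `1`. -/
theorem val_tpow {n : ℕ} (t : sig.Term ℕ) (m : ℕ) (c : chain n) :
    val (tpow t m) c = max 0 (1 - m * (1 - val t c)) := by
  induction m with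
  | zero => simp [tpow, val_timp]
  | succ m ih =>
    have h1 := val_le_one t c
    rw [tpow, val_tinf, ih]
    push_cast
    rcases le_total 0 (1 - m * (1 - val t c)) with h | h
    · rw [max_eq_right h]; congr 1; ring
    · rw [max_eq_left h, max_eq_left (by linarith), max_eq_left (by linarith)]

theorem val_tpow_of_eq_one {n : ℕ} {t : sig.Term ℕ} (m : ℕ) {c : chain n} (h : val t c = 1) :
    val (tpow t m) c = 1 := by
  simp [val_tpow, h]

/-- The distance to `1` is a multiple of `1/n`, so `n`-th powers are Boolean-valued. The exception
is needed because `chain 0` is all of `[0, 1] ∩ ℚ`. -/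
theorem one_le_mul_of_mem_chain {n : ℕ} {x : ℚ} (hx : x ∈ chain n) (h : x < 1) :
    1 ≤ n * (1 - x) ∨ n = 0 := by
  rcases Nat.eq_zero_or_pos n with h0 | hn
  · exact .inr h0
  obtain ⟨_, _, z, hz⟩ := neg_mem_chain hx
  left
  rw [hz]
  have hn' : (0 : ℚ) < n := by exact_mod_cast hn
  have : (0 : ℚ) < z := by rw [← hz]; exact mul_pos hn' (by linarith)
  exact_mod_cast this

theorem val_tpow_of_lt_one {n : ℕ} (hn : 0 < n) {t : sig.Term ℕ} {c : chain n}
    (h : val t c < 1) : val (tpow t n) c = 0 := by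
  have := (one_le_mul_of_mem_chain (n := n) (t.realize fun _ => c : chain n).2 h).resolve_right
    hn.ne'
  rw [val_tpow, max_eq_left]
  unfold val
  linarith

/-- While both values lie in the same half of `[0, 1]`, `s ⊕ s` or `s ⊙ s` doubles their gap. A gap
cannot exceed `1`, so within `m` doublings the values straddle `1/2`, and then `s ⊕ s` is the
required term. -/
theorem exists_term_of_gap {n : ℕ} {i j : chain n} (m : ℕ) (s : sig.Term ℕ)
    (h : 1 < 2 ^ m * (val s j - val s i)) : ∃ t, val t i < 1 ∧ val t j = 1 := by
  induction m generalizing s with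
  | zero =>
    have := val_nonneg s i
    have := val_le_one s j
    linarith
  | succ m ih =>
    have hi0 := val_nonneg s i
    have hj1 := val_le_one s j
    have hp : (0 : ℚ) < 2 ^ m := by positivity
    have hlt : val s i < val s j := by
      by_contra hle
      rw [pow_succ] at h
      nlinarith
    rcases le_or_gt (val s j) (1 / 2) with hj | hj
    · apply ih (tsup s s)
      rw [val_tsup, val_tsup, min_eq_right (by linarith), min_eq_right (by linarith)]
      rw [pow_succ] at h
      linarith
    · rcases le_or_gt (1 / 2) (val s i) with hi | hi
      · apply ih (tinf s s)
        rw [val_tinf, val_tinf, max_eq_right (by linarith), max_eq_right (by linarith)]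
        rw [pow_succ] at h
        linarith
      · refine ⟨tsup s s, ?_, ?_⟩
        · rw [val_tsup, min_eq_right (by linarith)]; linarith
        · rw [val_tsup, min_eq_left (by linarith)]

theorem exists_term_of_lt {n : ℕ} {i j : chain n} (h : (i : ℚ) < j) :
    ∃ t, val t i < 1 ∧ val t j = 1 := by
  have hd : (0 : ℚ) < j - i := sub_pos.2 h
  obtain ⟨m, hm⟩ := pow_unbounded_of_one_lt (1 / ((j : ℚ) - i)) (one_lt_two)
  refine exists_term_of_gap m (Term.var 0) ?_
  rw [val_var, val_var]
  rwa [div_lt_iff₀ hd] at hm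

theorem exists_separating_term {n : ℕ} (hn : 0 < n) {i j : chain n} (h : i ≠ j) :
    ∃ t, val t i = 1 ∧ val t j = 0 := by
  rcases lt_or_gt_of_ne (Subtype.coe_ne_coe.2 h) with hlt | hlt
  · obtain ⟨t, hi, hj⟩ := exists_term_of_lt hlt
    refine ⟨tneg (tpow t n), ?_, ?_⟩
    · rw [val_tneg, val_tpow_of_lt_one hn hi, sub_zero]
    · rw [val_tneg, val_tpow_of_eq_one n hj, sub_self]
  · obtain ⟨t, hj, hi⟩ := exists_term_of_lt hlt
    exact ⟨tpow t n, val_tpow_of_eq_one n hi, val_tpow_of_lt_one hn hj⟩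

theorem finite_chain {n : ℕ} (hn : 0 < n) : Finite (chain n) := by
  have : chain n ⊆ (fun i : ℕ => (i : ℚ) / n) '' Set.Iic n := by
    intro x hx
    obtain ⟨i, hi, rfl⟩ := (mem_chain_iff hn x).1 hx
    exact ⟨i, hi, rfl⟩
  exact ((Set.finite_Iic n).image _).subset this

theorem exists_indicator_term {n : ℕ} (hn : 0 < n) (i : chain n) :
    ∃ t, val t i = 1 ∧ ∀ j ≠ i, val t j = 0 := by
  classical
  have := finite_chain hn
  have := Fintype.ofFinite (chain n)
  have key : ∀ s : Finset (chain n), ∃ t, val t i = 1 ∧ ∀ j ∈ s, j ≠ i → val t j = 0 := by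
    intro s
    induction s using Finset.induction_on with
    | empty => exact ⟨timp (Term.var 0) (Term.var 0), by simp [val_timp], by simp⟩
    | insert b s _ ih =>
      obtain ⟨t, hti, ht⟩ := ih
      by_cases hb : b = i
      · refine ⟨t, hti, fun j hj hji => ?_⟩
        rcases Finset.mem_insert.1 hj with rfl | hj
        · exact absurd hb hji
        · exact ht j hj hji
      · obtain ⟨r, hri, hrb⟩ := exists_separating_term hn (Ne.symm hb)
        refine ⟨tinf t r, by rw [val_tinf, hti, hri]; norm_num, fun j hj hji => ?_⟩
        rw [val_tinf]
        apply max_eq_left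
        rcases Finset.mem_insert.1 hj with rfl | hj
        · have := val_le_one t j
          linarith
        · have := val_le_one r j
          rw [ht j hj hji]
          linarith
  obtain ⟨t, hti, ht⟩ := key Finset.univ
  exact ⟨t, hti, fun j hj => ht j (Finset.mem_univ j) hj⟩

/-- The values at `i` of the unary terms form a chain `ŁV_{N+1}`. -/
theorem exists_subchain {n : ℕ} (hn : 0 < n) (i : chain n) (h0 : (i : ℚ) ≠ 0)
    (h1 : (i : ℚ) ≠ 1) :
    ∃ N, 1 < N ∧ N ∣ n ∧ ∀ r ≤ N, ∃ t, val t i = (r : ℚ) / N := by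
  classical
  have hn' : (0 : ℚ) < n := by exact_mod_cast hn
  have hex : ∃ m : ℕ, 0 < m ∧ ∃ t, val t i = (m : ℚ) / n :=
    ⟨n, hn, timp (Term.var 0) (Term.var 0), by rw [div_self hn'.ne']; simp [val_timp]⟩
  obtain ⟨hm, tm, htm⟩ := Nat.find_spec hex
  have hmin : ∀ b : ℕ, 0 < b → (∃ t, val t i = (b : ℚ) / n) → Nat.find hex ≤ b :=
    fun b hb hb' => Nat.find_min' hex ⟨hb, hb'⟩
  generalize Nat.find hex = m at hm htm hmin
  -- Here `m / n` is the least positive value at `i`. Truncated subtraction `t ⊙ ¬ tm` subtracts it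
  -- from any larger value, so descent shows that all values are multiples of it.
  have hdvd : ∀ b : ℕ, (∃ t, val t i = (b : ℚ) / n) → m ∣ b := by
    intro b
    induction b using Nat.strong_induction_on with
    | _ b ih =>
      rintro ⟨t, ht⟩
      rcases Nat.eq_zero_or_pos b with rfl | hb
      · exact dvd_zero m
      have hmb := hmin b hb ⟨t, ht⟩
      have hsub : m ∣ b - m := by
        refine ih (b - m) (by omega) ⟨tinf t (tneg tm), ?_⟩
        have hle : (m : ℚ) / n ≤ b / n := by
          apply div_le_div_of_nonneg_right _ hn'.le
          exact_mod_cast hmb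
        rw [val_tinf, val_tneg, ht, htm, max_eq_right (by linarith), Nat.cast_sub hmb, sub_div]
        ring
      exact (Nat.dvd_sub_iff_left hmb dvd_rfl).1 hsub
  have hmul : ∀ r : ℕ, r * m ≤ n → ∃ t, val t i = ((r * m : ℕ) : ℚ) / n := by
    intro r
    induction r with
    | zero =>
      intro _
      exact ⟨tneg (timp (Term.var 0) (Term.var 0)), by simp [val_tneg, val_timp]⟩
    | succ r ih =>
      intro hr
      rw [add_mul, one_mul] at hr ⊢
      obtain ⟨t, ht⟩ := ih (by omega)
      refine ⟨tsup t tm, ?_⟩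
      rw [val_tsup, ht, htm, ← add_div, ← Nat.cast_add, min_eq_right]
      rw [div_le_one hn']
      exact_mod_cast hr
  obtain ⟨N, hN⟩ := hdvd n ⟨timp (Term.var 0) (Term.var 0), by
    rw [div_self hn'.ne']; simp [val_timp]⟩
  -- The point `i = p / n` is itself a value, so `m ≤ p < n = m * N`, which forces `N > 1`.
  obtain ⟨p, hp, hip⟩ := (mem_chain_iff hn _).1 i.2
  have hmp := hdvd p ⟨Term.var 0, by rw [val_var, hip]⟩
  have hp0 : p ≠ 0 := by rintro rfl; simp [hip] at h0
  have hpn : p ≠ n := by rintro rfl; rw [hip, div_self hn'.ne'] at h1; exact h1 rfl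
  have hN1 : 1 < N := by
    by_contra hN1
    have : m ≤ p := Nat.le_of_dvd (Nat.pos_of_ne_zero hp0) hmp
    have : m * N ≤ m * 1 := Nat.mul_le_mul_left m (by omega)
    omega
  refine ⟨N, hN1, ⟨m, by rw [hN, mul_comm]⟩, fun r hr => ?_⟩
  obtain ⟨t, ht⟩ := hmul r (by rw [hN, mul_comm]; exact Nat.mul_le_mul_left m hr)
  refine ⟨t, ?_⟩
  have hm' : (m : ℚ) ≠ 0 := by exact_mod_cast hm.ne'
  have hN' : (N : ℚ) ≠ 0 := by positivity
  rw [ht, hN]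
  push_cast
  field_simp

/-- Terms taking a prescribed value at `i` and a constant Boolean value elsewhere. -/
theorem exists_term_with_values {n : ℕ} (hn : 0 < n) {i : chain n} {s : sig.Term ℕ} {ε : ℚ}
    (hε : ε = 0 ∨ ε = 1) : ∃ t, val t i = val s i ∧ ∀ j ≠ i, val t j = ε := by
  obtain ⟨χ, hi, hj⟩ := exists_indicator_term hn i
  rcases hε with rfl | rfl
  · refine ⟨tinf χ s, ?_, fun j hji => ?_⟩
    · rw [val_tinf, hi, max_eq_right] <;> linarith [val_nonneg s i]
    · rw [val_tinf, hj j hji, max_eq_left]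
      linarith [val_le_one s j]
  · refine ⟨tsup (tneg χ) s, ?_, fun j hji => ?_⟩
    · rw [val_tsup, val_tneg, hi, min_eq_right] <;> linarith [val_le_one s i]
    · rw [val_tsup, val_tneg, hj j hji, min_eq_left]
      linarith [val_nonneg s j]

/-! ### Non-Boolean algebras in `𝒬(ŁV_{k+1})` -/

theorem val_eq_val_iff {n : ℕ} {s t : sig.Term ℕ} {c : chain n} :
    val s c = val t c ↔ (s.realize fun _ => c) = t.realize fun _ => c :=
  Subtype.coe_inj

/-- Identifying all variables turns the hypothesis on `chain k` into a valid quasi-equation in one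
variable, which passes to `A`. -/
theorem realize_eq_of_val {k : ℕ} {A : Alg.{u}} (hA : A ∈ generated (chain k))
    (P : List (sig.Term ℕ × sig.Term ℕ)) (s t : sig.Term ℕ)
    (h : ∀ c : chain k, (∀ p ∈ P, val p.1 c = val p.2 c) → val s c = val t c) (a : A)
    (ha : ∀ p ∈ P, (p.1.realize fun _ => a) = p.2.realize fun _ => a) :
    (s.realize fun _ => a) = t.realize fun _ => a := by
  have hv : ((QuasiEquation.mk P (s, t)).subst fun _ => Term.var 0).Valid (chain k) := by
    refine QuasiEquation.Valid.subst fun x hx => ?_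
    exact val_eq_val_iff.1 (h (x 0) fun p hp => val_eq_val_iff.2 (hx p hp))
  exact (hA _ hv).of_subst (fun _ => a) ha

/-- If every element of `A ∈ 𝒬(ŁV_{k+1})` is idempotent, then `A ∈ 𝒬(ŁV_2)`. -/
theorem mem_generated_chain_one {k : ℕ} (hk : 0 < k) {A : Alg.{u}}
    (hA : A ∈ generated (chain k)) (h : ∀ a : A, neg (imp a (neg a)) = a) :
    A ∈ generated (chain 1) := by
  intro e he
  have hB := valid_chain_one_iff.1 he
  -- On the chain `k`-th powers are Boolean, so `e` holds for them; in `A` idempotence makes each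
  -- element equal to its `k`-th power, which undoes the substitution.
  have hv : (e.subst fun m => tpow (Term.var m) k).Valid (chain k) := by
    refine QuasiEquation.Valid.subst fun x hx => ?_
    have hx' : ∀ m, ∃ b, (tpow (Term.var m) k).realize x = ofBool k b := by
      intro m
      have hr : (tpow (Term.var m) k).realize x =
          (tpow (Term.var m) k).realize fun _ => x m := by
        have : ∀ l, (tpow (Term.var m) l).realize x =
            (tpow (Term.var m) l).realize fun _ => x m := by
          intro l
          induction l with
          | zero => simp [tpow]
          | succ l ih => simp [tpow, tinf, ih]
        exact this k
      rcases eq_or_lt_of_le (val_le_one (Term.var m) (x m)) with h1 | h1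
      · exact ⟨true, Subtype.ext (by rw [hr]; exact val_tpow_of_eq_one k h1)⟩
      · exact ⟨false, Subtype.ext (by rw [hr]; exact val_tpow_of_lt_one hk h1)⟩
    choose b hb using hx'
    simp only [hb, ← (isHom_ofBool k).map_realize] at hx ⊢
    rw [hB b fun p hp => ofBool_injective k (hx p hp)]
  intro x hx
  have hpow : ∀ m, ∀ l, 0 < l → (tpow (Term.var m) l).realize x = x m := by
    intro m l hl
    induction l with
    | zero => omega
    | succ l ih =>
      rcases Nat.eq_zero_or_pos l with rfl | hl'
      · have := realize_eq_of_val hA [] (tpow (Term.var 0) 1) (Term.var 0) (fun c _ => by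
          simp [val_tpow, val_nonneg]) (x m) (by simp)
        simpa [tpow, tinf] using this
      · simp [tpow, tinf, ih hl', h]
  have := (hA _ hv).of_subst x
  simp only [hpow _ k hk] at this
  exact this hx

/-- A non-idempotent element has a non-Boolean specialization in the chain. -/
theorem exists_specialization {k : ℕ} (hk : 0 < k) {A : Alg.{u}}
    (hA : A ∈ generated (chain k)) {a : A} (ha : neg (imp a (neg a)) ≠ a) :
    ∃ i : chain k, (i : ℚ) ≠ 0 ∧ (i : ℚ) ≠ 1 ∧ ∀ s t : sig.Term ℕ,
      ((s.realize fun _ => a) = t.realize fun _ => a) → val s i = val t i := by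
  classical
  -- Otherwise each inner point violates some equation true at `a`. As the chain is finite, these
  -- equations together are the premises of a quasi-equation that leaves only the points `0` and
  -- `1`, hence implies idempotence; it passes to `A`.
  by_contra! hcon
  have := finite_chain hk
  have := Fintype.ofFinite (chain k)
  have hp : ∀ i : chain k, ∃ p : sig.Term ℕ × sig.Term ℕ,
      ((p.1.realize fun _ => a) = p.2.realize fun _ => a) ∧
        ((i : ℚ) ≠ 0 → (i : ℚ) ≠ 1 → val p.1 i ≠ val p.2 i) := by
    intro i
    by_cases h : (i : ℚ) ≠ 0 ∧ (i : ℚ) ≠ 1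
    · obtain ⟨s, t, hst, hne⟩ := hcon i h.1 h.2
      exact ⟨(s, t), hst, fun _ _ => hne⟩
    · exact ⟨(Term.var 0, Term.var 0), rfl, fun h0 h1 => absurd ⟨h0, h1⟩ h⟩
  choose p hpa hpi using hp
  apply ha
  have := realize_eq_of_val hA ((Finset.univ : Finset (chain k)).toList.map p)
    (tinf (Term.var 0) (Term.var 0)) (Term.var 0) (fun c hc => ?_) a ?_
  · simpa [tinf] using this
  · have hc' := hc (p c) (List.mem_map_of_mem (by simp))
    rw [val_tinf, val_var]
    by_cases h0 : (c : ℚ) = 0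
    · simp [h0]
    by_cases h1 : (c : ℚ) = 1
    · simp [h1]
    exact absurd hc' (hpi c h0 h1)
  · intro r hr
    obtain ⟨c, -, rfl⟩ := List.mem_map.1 hr
    exact hpa c

/-- The quasi-equations of a non-Boolean algebra in `𝒬(ŁV_{k+1})` which hold in `ŁV_2` hold in
some `ŁV_{q+1} × ŁV_2`. -/
theorem exists_prime_valid {k : ℕ} (hk : 0 < k) {A : Alg.{u}} (hA : A ∈ generated (chain k))
    (hA' : A ∉ generated (chain 1)) : ∃ q : ℕ, q.Prime ∧ q ∣ k ∧ ∀ e : QuasiEquation,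
      e.Valid A → e.Valid (chain 1) → e.Valid (chain q × chain 1) := by
  have hex : ∃ a : A, neg (imp a (neg a)) ≠ a := by
    by_contra! h
    exact hA' (mem_generated_chain_one hk hA h)
  obtain ⟨a, ha⟩ := hex
  obtain ⟨i, h0, h1, hi⟩ := exists_specialization hk hA ha
  obtain ⟨N, hN, hNk, hval⟩ := exists_subchain hk i h0 h1
  have hq := Nat.minFac_prime hN.ne'
  have hqN := Nat.minFac_dvd N
  generalize N.minFac = q at hq hqN
  have hq' : q ∣ k := hqN.trans hNk
  refine ⟨q, hq, hq', fun e he he' x hx => ?_⟩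
  -- `F m` encodes the pair `x m` as a unary term; by `e1` and `e2` below, substituting `F` then
  -- encodes the value of every term at `x`.
  have hF : ∀ m, ∃ t : sig.Term ℕ, val t i = (x m).1 ∧ ∀ j ≠ i, val t j = (x m).2 := by
    intro m
    obtain ⟨r, hr, hxr⟩ := (mem_chain_iff (by omega) _).1 (chain_subset hqN (x m).1.2)
    obtain ⟨s, hs⟩ := hval r hr
    rw [hxr, ← hs]
    exact exists_term_with_values hk (chain_one_cases _)
  choose F hFi hFj using hF
  have e1 : ∀ t : sig.Term ℕ, val (t.subst F) i = ((t.realize x).1 : ℚ) := by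
    intro t
    rw [val, Term.realize_subst, isHom_fst.map_realize x t]
    have : (fun m => (F m).realize fun _ => i) =
        fun m => Set.inclusion (chain_subset hq') (x m).1 :=
      funext fun m => Subtype.ext (hFi m)
    rw [this, ← (isHom_inclusion hq').map_realize]
  have e2 : ∀ t : sig.Term ℕ, ∀ j ≠ i, val (t.subst F) j = ((t.realize x).2 : ℚ) := by
    intro t j hj
    rw [val, Term.realize_subst, isHom_snd.map_realize x t]
    have : (fun m => (F m).realize fun _ => j) =
        fun m => Set.inclusion (chain_subset (one_dvd k)) (x m).2 :=
      funext fun m => Subtype.ext (hFj m j hj)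
    rw [this, ← (isHom_inclusion (one_dvd k)).map_realize]
  apply Prod.ext
  · apply Subtype.ext
    rw [← e1, ← e1]
    apply hi
    rw [Term.realize_subst, Term.realize_subst]
    refine he _ fun p hp => ?_
    rw [← Term.realize_subst, ← Term.realize_subst]
    -- Premises true at `x` become identities in one variable on the whole chain, hence hold at `a`;
    -- the conclusion, obtained in `A`, returns to the chain only at `i`.
    refine realize_eq_of_val hA [] _ _ (fun c _ => ?_) a (by simp)
    by_cases hc : c = i
    · rw [hc, e1, e1, hx p hp]
    · rw [e2 _ c hc, e2 _ c hc, hx p hp]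
  -- Nothing is known at the points other than `i`, so the second coordinate relies on validity in
  -- `ŁV_2`.
  · rw [isHom_snd.map_realize, isHom_snd.map_realize]
    refine he' _ fun p hp => ?_
    rw [← isHom_snd.map_realize, ← isHom_snd.map_realize, hx p hp]

/-! ### Minimal quasivarieties above the Boolean algebras -/

/-- The chains live in `Type`; lifted copies make them members of classes of algebras in any
universe. -/
instance instStructureULift (M : Type v) [sig.Structure M] :
    sig.Structure (ULift.{u} M) where
  funMap f x := ⟨funMap f fun i => (x i).down⟩
  RelMap r _ := Empty.elim r

instance instNonemptyChain (n : ℕ) : Nonempty (chain n) := ⟨⟨1, one_mem_chain n⟩⟩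

/-- A small algebra, lifted to an arbitrary universe. -/
def lift (M : Type) [sig.Structure M] [Nonempty M] : Alg.{u} :=
  Theory.ModelType.of (∅ : sig.Theory) (ULift.{u} M)

theorem isHom_down (M : Type v) [sig.Structure M] :
    IsHom (ULift.down : ULift.{u} M → M) := by
  refine ⟨fun x => congrArg (funMap (L := sig) (n := 1) Op.neg) (funext fun j => ?_),
    fun x y => congrArg (funMap (L := sig) (n := 2) Op.imp) (funext fun j => ?_)⟩ <;>
  fin_cases j <;> rfl

theorem isHom_up (M : Type v) [sig.Structure M] :
    IsHom (ULift.up : M → ULift.{u} M) :=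
  ⟨fun x => (congrArg ULift.up ((isHom_down M).1 ⟨x⟩)).symm,
    fun x y => (congrArg ULift.up ((isHom_down M).2 ⟨x⟩ ⟨y⟩)).symm⟩

theorem valid_lift_iff {e : QuasiEquation} (M : Type) [sig.Structure M] [Nonempty M] :
    e.Valid (lift.{u} M) ↔ e.Valid M :=
  ⟨fun h => QuasiEquation.Valid.of_injective (N := ULift.{u} M) h (isHom_up M)
    ULift.up_injective,
   fun h => QuasiEquation.Valid.of_injective (M := ULift.{u} M) h (isHom_down M)
    ULift.down_injective⟩

theorem generated_subset_of_dvd {k q : ℕ} (h : q ∣ k) :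
    generated.{u} (chain q × chain 1) ⊆ generated (chain k) := fun _ hM e he =>
  hM e (.prod (he.of_injective (isHom_inclusion h) (Set.inclusion_injective _))
    (he.of_injective (isHom_inclusion (one_dvd k)) (Set.inclusion_injective _)))

/-- `ŁV_2` embeds diagonally in the product, while idempotence, an identity of `ŁV_2`, fails at
`(1/q, 1)`. -/
theorem ssubset_generated {q : ℕ} (hq : 1 < q) :
    booleanAlgebras.{u} ⊂ generated (chain q × chain 1) := by
  rw [booleanAlgebras_eq_generated]
  constructor
  · intro M hM e he
    refine hM e (he.of_injective
      (f := fun x => (Set.inclusion (chain_subset (one_dvd q)) x, x)) ⟨fun x => ?_, fun x y => ?_⟩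
      fun x y h => congrArg Prod.snd h)
    · exact Prod.ext (by rw [isHom_fst.1]; rfl) (by rw [isHom_snd.1])
    · exact Prod.ext (by rw [isHom_fst.2]; rfl) (by rw [isHom_snd.2])
  · intro hsub
    let e : QuasiEquation := ⟨[], (tinf (Term.var 0) (Term.var 0), Term.var 0)⟩
    have hM : lift.{u} (chain q × chain 1) ∈ generated (chain q × chain 1) :=
      fun e he => (valid_lift_iff _).2 he
    have h1 : e.Valid (chain 1) := by
      rw [valid_chain_one_iff]
      intro v _
      simp [e, tinf]
    have h2 : e.Valid (chain q × chain 1) := (valid_lift_iff _).1 (hsub hM e h1)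
    have hq' : (0 : ℚ) < q := by positivity
    have hq1 : (1 : ℚ) < q := by exact_mod_cast hq
    let c : chain q := ⟨1 / q, (mem_chain_iff hq.le _).2 ⟨1, hq.le, by simp⟩⟩
    have h3 := congrArg Prod.fst (h2 (fun _ => (c, ⟨1, one_mem_chain 1⟩)) (by simp [e]))
    rw [isHom_fst.map_realize, isHom_fst.map_realize] at h3
    have h4 : val (tinf (Term.var 0) (Term.var 0)) c = val (Term.var 0) c :=
      congrArg Subtype.val h3
    rw [val_tinf, val_var] at h4
    have hc : (c : ℚ) = 1 / q := rfl
    have hc0 : (0 : ℚ) < c := by rw [hc]; positivity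
    have hc1 : (c : ℚ) < 1 := by rw [hc, div_lt_one hq']; exact hq1
    rcases max_choice (0 : ℚ) ((c : ℚ) + c - 1) with h | h <;> rw [h] at h4 <;> linarith

theorem isSubquasivarietyAbove_generated {k q : ℕ} (hq : q.Prime) (h : q ∣ k) :
    IsSubquasivarietyAbove (generated (chain k)) booleanAlgebras.{u}
      (generated (chain q × chain 1)) :=
  ⟨⟨_, rfl⟩, generated_subset_of_dvd h, ssubset_generated hq.one_lt⟩

theorem exists_generated_subset {k : ℕ} (hk : 0 < k) {K : Set Alg.{u}}
    (hK : IsSubquasivarietyAbove (generated (chain k)) booleanAlgebras K) :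
    ∃ q : ℕ, q.Prime ∧ q ∣ k ∧ generated (chain q × chain 1) ⊆ K := by
  obtain ⟨⟨S, rfl⟩, hV, hB⟩ := hK
  rw [booleanAlgebras_eq_generated] at hB
  obtain ⟨A, hAK, hA⟩ := Set.exists_of_ssubset hB
  obtain ⟨q, hq, hqk, h⟩ := exists_prime_valid hk (hV hAK) hA
  -- Each axiom of the class holds in `A` and also in `ŁV_2`, whose lift belongs to the class.
  refine ⟨q, hq, hqk, fun M hM e he => hM e (h e (hAK e he) ?_)⟩
  have h1 : lift.{u} (chain 1) ∈ generated (chain 1) := fun e he => (valid_lift_iff _).2 he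
  exact (valid_lift_iff _).1 (hB.1 h1 e he)

theorem minimal_generated {k q : ℕ} (hq : q.Prime) (h : q ∣ k) :
    Minimal (IsSubquasivarietyAbove (generated (chain k)) booleanAlgebras.{u})
      (generated (chain q × chain 1)) := by
  refine ⟨isSubquasivarietyAbove_generated hq h, fun K hK hle => ?_⟩
  have hK' : IsSubquasivarietyAbove (generated (chain q)) booleanAlgebras K :=
    ⟨hK.1, hle.trans (generated_subset_of_dvd dvd_rfl), hK.2.2⟩
  obtain ⟨r, hr, hrq, hsub⟩ := exists_generated_subset hq.pos hK'
  rw [(Nat.prime_dvd_prime_iff_eq hr hq).1 hrq] at hsub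
  exact hsub

end Lukasiewicz

theorem mainTheorem8 (k : ℕ) (hk : 1 < k) :
    (Lukasiewicz.booleanAlgebras.{u} = Lukasiewicz.generated (Lukasiewicz.chain 1)) ∧
    {K : Set Lukasiewicz.Alg.{u} |
        Minimal (Lukasiewicz.IsSubquasivarietyAbove
          (Lukasiewicz.generated (Lukasiewicz.chain k)) Lukasiewicz.booleanAlgebras) K} =
      {K : Set Lukasiewicz.Alg.{u} | ∃ q : ℕ, q.Prime ∧ q ∣ k ∧
        K = Lukasiewicz.generated (Lukasiewicz.chain q × Lukasiewicz.chain 1)} := by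
  refine ⟨Lukasiewicz.booleanAlgebras_eq_generated, Set.ext fun K => ⟨fun hK => ?_, ?_⟩⟩
  · obtain ⟨q, hq, hqk, hsub⟩ :=
      Lukasiewicz.exists_generated_subset (zero_lt_one.trans hk) hK.prop
    exact ⟨q, hq, hqk, le_antisymm
      (hK.2 (Lukasiewicz.isSubquasivarietyAbove_generated hq hqk) hsub) hsub⟩
  · rintro ⟨q, hq, hqk, rfl⟩
    exact Lukasiewicz.minimal_generated hq hqk
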